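/- Let $k$ be a field of characteristic zero and let $n\ge 2$. Let $\mathcal{NU}_n$ be the symmetric operad over $k$ generated by one binary operation $(x_1,x_2)\mapsto x_1x_2$ without any symmetry, subject to the identities of $2n$ arguments $$f([x_1,x_2],[x_3,x_4],\dots,[x_{2n-1},x_{2n}])=0,\qquad [a,b]:=ab-ba,$$ for all $n$-ary compositions $f$ of multiplications (all bracketings, with the arguments in any order). That is, $\mathcal{NU}_n$ is the quotient of the free symmetric operad on the multiplication by the operadic ideal generated by these elements. (These identities hold in the algebras of upper triangular $n\times n$ matrices over commutative nonassociative rings.) Then the exponential generating series $$E_{\mathcal{NU}_n}(z)=\sum_{m\ge 1}\frac{\dim_k \mathcal{NU}_n(m)}{m!}\,z^m\in\mathbb{Q}[[z]]$$ is algebraic, i.e. there is a nonzero polynomial $P(z,y)\in\mathbb{Q}[z,y]$ with $P(z,E_{\mathcal{NU}_n}(z))=0$. -/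

import Mathlib

open scoped Polynomial PowerSeries

noncomputable section

namespace MagmaticOperad

/-! ### Nonassociative polynomials of a given multidegree -/

/-- The multiset of the variables at the leaves of a nonassociative monomial
(a planar binary tree whose leaves are labelled by variables). -/
def leaves {X : Type*} : FreeMagma X → Multiset X
  | FreeMagma.of x => {x}
  | FreeMagma.mul s t => leaves s + leaves t

/-- The span of the monomials whose multiset of leaves is `S`, inside the free nonunital
nonassociative algebra on `X`. -/
def homogeneous (k : Type*) [Field k] {X : Type*} (S : Multiset X) :
    Submodule k (FreeNonUnitalNonAssocAlgebra k X) :=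
  Submodule.span k (MonoidAlgebra.ofMagma k (FreeMagma X) '' {t | leaves t = S})

section helpers

variable {k : Type*} [Field k] {X Y : Type*}

theorem of_mem_homogeneous (x : X) :
    FreeNonUnitalNonAssocAlgebra.of k x ∈ homogeneous k ({x} : Multiset X) :=
  Submodule.subset_span ⟨FreeMagma.of x, rfl, rfl⟩

theorem mul_mem_homogeneous {S T : Multiset X} {p q : FreeNonUnitalNonAssocAlgebra k X}
    (hp : p ∈ homogeneous k S) (hq : q ∈ homogeneous k T) :
    p * q ∈ homogeneous k (S + T) := by
  induction hp using Submodule.span_induction with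
  | zero => simp
  | add x y _ _ hx hy => rw [add_mul]; exact add_mem hx hy
  | smul a x _ hx => rw [smul_mul_assoc]; exact Submodule.smul_mem _ _ hx
  | mem x hx =>
    obtain ⟨s, hs, rfl⟩ := hx
    induction hq using Submodule.span_induction with
    | zero => simp
    | add x y _ _ hx hy => rw [mul_add]; exact add_mem hx hy
    | smul a x _ hx => rw [mul_smul_comm]; exact Submodule.smul_mem _ _ hx
    | mem y hy =>
      obtain ⟨t, ht, rfl⟩ := hy
      rw [← map_mul]
      refine Submodule.subset_span ⟨s * t, ?_, rfl⟩
      change leaves s + leaves t = S + T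
      rw [hs, ht]

theorem lift_mem_homogeneous {B : X → Multiset Y} {v : X → FreeNonUnitalNonAssocAlgebra k Y}
    (hv : ∀ x, v x ∈ homogeneous k (B x)) {S : Multiset X}
    {p : FreeNonUnitalNonAssocAlgebra k X} (hp : p ∈ homogeneous k S) :
    FreeNonUnitalNonAssocAlgebra.lift k v p ∈ homogeneous k (S.bind B) := by
  have key : ∀ t : FreeMagma X,
      FreeNonUnitalNonAssocAlgebra.lift k v (MonoidAlgebra.ofMagma k (FreeMagma X) t) ∈
        homogeneous k ((leaves t).bind B) := by
    intro t
    induction t with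
    | ih1 x =>
      have h := FreeNonUnitalNonAssocAlgebra.lift_of_apply (R := k) v x
      have h2 : (leaves (FreeMagma.of x)).bind B = B x := by simp [leaves]
      rw [h2]
      exact h ▸ hv x
    | ih2 s t hs ht =>
      rw [map_mul, map_mul]
      have h2 : (leaves (s * t)).bind B = (leaves s).bind B + (leaves t).bind B :=
        Multiset.add_bind _ _ _
      rw [h2]
      exact mul_mem_homogeneous hs ht
  induction hp using Submodule.span_induction with
  | zero => simp
  | add x y _ _ hx hy => rw [map_add]; exact add_mem hx hy
  | smul a x _ hx => rw [map_smul]; exact Submodule.smul_mem _ _ hx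
  | mem x hx =>
    obtain ⟨t, ht, rfl⟩ := hx
    have := key t
    rwa [show leaves t = S from ht] at this

theorem eq_univ_val {m : ℕ} {s : Multiset (Fin m)} (h : ∀ a, a ∈ s)
    (hc : Multiset.card s ≤ m) : s = (Finset.univ : Finset (Fin m)).val := by
  refine (Multiset.eq_of_le_of_card_le ?_ ?_).symm
  · exact (Multiset.le_iff_subset Finset.univ.nodup).2 fun a _ => h a
  · simpa using hc

theorem finite_leaves_eq (S : Multiset X) : {t : FreeMagma X | leaves t = S}.Finite := by
  induction S using Multiset.strongInductionOn with
  | ih S ih =>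
    have hpos : ∀ t : FreeMagma X, leaves t ≠ 0 := by
      intro t
      induction t with
      | ih1 x => simp [leaves]
      | ih2 s t hs ht =>
        change leaves s + leaves t ≠ 0
        simp [hs]
    have h1 : (FreeMagma.of '' {x : X | x ∈ S}).Finite := by
      classical
      exact Set.Finite.image _ ((S.toFinset.finite_toSet).subset fun x hx => by simpa using hx)
    have h2 : (⋃ A ∈ {A : Multiset X | A < S},
        {t : FreeMagma X | leaves t = A}).Finite := by
      classical
      refine Set.Finite.biUnion ?_ fun A hA => ih A hA
      exact ((S.powerset.toFinset).finite_toSet).subset fun A hA => by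
        simpa using le_of_lt hA
    refine (h1.union (Set.Finite.image2 (· * ·) h2 h2)).subset ?_
    intro t ht
    cases t with
    | of x =>
      left
      refine ⟨x, ?_, rfl⟩
      have : ({x} : Multiset X) = S := ht
      simp [← this]
    | mul s t =>
      right
      have h : leaves s + leaves t = S := ht
      refine ⟨s, ?_, t, ?_, rfl⟩
      · simp only [Set.mem_iUnion, Set.mem_ofPred_eq, exists_prop]
        exact ⟨_, h ▸ lt_add_of_pos_right _ (pos_iff_ne_zero.2 (hpos t)), rfl⟩
      · simp only [Set.mem_iUnion, Set.mem_ofPred_eq, exists_prop]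
        exact ⟨_, h ▸ lt_add_of_pos_left _ (pos_iff_ne_zero.2 (hpos s)), rfl⟩

end helpers

/-! ### The free symmetric operad on one binary operation without symmetry -/

/-- The arity `m` component of the free symmetric operad over `k` generated by one binary
operation `μ = x₁x₂` (with its opposite `x₂x₁`): the multilinear nonassociative polynomials in
`m` variables, spanned by the planar binary trees whose leaves are bijectively labelled by
`Fin m`. Variables are numbered from `0`. -/
def Mag (k : Type*) [Field k] (m : ℕ) : Submodule k (FreeNonUnitalNonAssocAlgebra k (Fin m)) :=
  homogeneous k (Finset.univ : Finset (Fin m)).val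

variable {k : Type*} [Field k]

instance (m : ℕ) : Module.Finite k (Mag k m) :=
  Module.Finite.span_of_finite k (Set.Finite.image _ (finite_leaves_eq _))

/-- The action of the symmetric group by renaming the inputs: `xᵢ ↦ x_{σ i}`. -/
def act {m : ℕ} (σ : Equiv.Perm (Fin m)) (f : Mag k m) : Mag k m :=
  ⟨FreeNonUnitalNonAssocAlgebra.lift k (fun i => FreeNonUnitalNonAssocAlgebra.of k (σ i)) f.1, by
    have h := lift_mem_homogeneous (B := fun i => {σ i})
      (fun i => of_mem_homogeneous (k := k) (σ i)) f.2
    rwa [eq_univ_val (s := Multiset.bind _ _)] at h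
    · intro a
      simp only [Multiset.mem_bind, Multiset.mem_singleton]
      exact ⟨σ.symm a, by simp, by simp⟩
    · simp⟩

/-- The substitution used in the partial composition at the input `i`:
`x_j ↦ x_j` for `j < i`, `x_i ↦ g(x_i, …, x_{i+l-1})`, and `x_j ↦ x_{j+l-1}` for `j > i`. -/
def compSubst {m l : ℕ} (i : Fin (m + 1)) (g : FreeNonUnitalNonAssocAlgebra k (Fin l))
    (j : Fin (m + 1)) : FreeNonUnitalNonAssocAlgebra k (Fin (m + l)) :=
  if hlt : (j : ℕ) < i then FreeNonUnitalNonAssocAlgebra.of k ⟨j, by omega⟩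
  else if heq : j = i then
    FreeNonUnitalNonAssocAlgebra.lift k
      (fun b : Fin l => FreeNonUnitalNonAssocAlgebra.of k (⟨i + b, by omega⟩ : Fin (m + l))) g
  else FreeNonUnitalNonAssocAlgebra.of k ⟨j + l - 1, by
    have := Fin.val_ne_of_ne heq
    omega⟩

/-- The leaves of the values of `compSubst`. -/
def compLeaves {m : ℕ} (l : ℕ) (i j : Fin (m + 1)) : Multiset (Fin (m + l)) :=
  if hlt : (j : ℕ) < i then {⟨j, by omega⟩}
  else if heq : j = i then
    (Finset.univ : Finset (Fin l)).val.bind fun b => {(⟨i + b, by omega⟩ : Fin (m + l))}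
  else {⟨j + l - 1, by
    have := Fin.val_ne_of_ne heq
    omega⟩}

theorem compSubst_mem {m l : ℕ} (i : Fin (m + 1)) (g : Mag k l) (j : Fin (m + 1)) :
    compSubst i g.1 j ∈ homogeneous k (compLeaves l i j) := by
  unfold compSubst compLeaves
  split_ifs with h1 h2
  · exact of_mem_homogeneous _
  · exact lift_mem_homogeneous (fun b => of_mem_homogeneous _) g.2
  · exact of_mem_homogeneous _

theorem bind_compLeaves {m : ℕ} (l : ℕ) (i : Fin (m + 1)) :
    (Finset.univ : Finset (Fin (m + 1))).val.bind (compLeaves l i) =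
      (Finset.univ : Finset (Fin (m + l))).val := by
  refine eq_univ_val (fun a => ?_) ?_
  · rw [Multiset.mem_bind]
    by_cases h1 : (a : ℕ) < i
    · refine ⟨⟨a, by omega⟩, by simp, ?_⟩
      simp [compLeaves, h1]
    · by_cases h2 : (a : ℕ) < i + l
      · refine ⟨i, by simp, ?_⟩
        simp only [compLeaves, lt_irrefl, dite_false, dite_true, Multiset.mem_bind,
          Multiset.mem_singleton]
        exact ⟨⟨a - i, by omega⟩, by simp, by ext; simp; omega⟩
      · refine ⟨⟨a + 1 - l, by omega⟩, by simp, ?_⟩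
        have h3 : ¬ ((a : ℕ) + 1 - l < i) := by omega
        have h4 : (⟨a + 1 - l, by omega⟩ : Fin (m + 1)) ≠ i := by
          intro h
          have := congrArg Fin.val h
          simp at this
          omega
        simp only [compLeaves, h3, h4, dite_false, Multiset.mem_singleton]
        ext
        simp
        omega
  · rw [Multiset.card_bind]
    change ∑ j, Multiset.card (compLeaves l i j) ≤ m + l
    rw [Fin.sum_univ_succAbove _ i]
    have h1 : Multiset.card (compLeaves l i i) = l := by simp [compLeaves]
    have h2 : ∀ j, Multiset.card (compLeaves l i (i.succAbove j)) = 1 := by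
      intro j
      have := Fin.succAbove_ne i j
      unfold compLeaves
      split_ifs <;> simp
    simp [h1, h2, add_comm]

/-- The partial composition `f ∘ᵢ g`, substituting `g` into the input `i` of `f`. -/
def comp {m l : ℕ} (f : Mag k (m + 1)) (i : Fin (m + 1)) (g : Mag k l) : Mag k (m + l) :=
  ⟨FreeNonUnitalNonAssocAlgebra.lift k (compSubst i g.1) f.1, by
    have h := lift_mem_homogeneous (compSubst_mem i g) f.2
    rwa [bind_compLeaves] at h⟩

/-! ### Operadic ideals and quotients -/

/-- An ideal of the free operad: subspaces of its components stable under the actions of the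
symmetric groups and under partial compositions, on either side, with arbitrary elements. -/
structure IsOperadicIdeal (J : ∀ m, Submodule k (Mag k m)) : Prop where
  act_mem : ∀ {m : ℕ} (σ : Equiv.Perm (Fin m)) {f : Mag k m}, f ∈ J m → act σ f ∈ J m
  comp_mem_of_left : ∀ {m l : ℕ} {f : Mag k (m + 1)} (i : Fin (m + 1)) (g : Mag k l),
    f ∈ J (m + 1) → comp f i g ∈ J (m + l)
  comp_mem_of_right : ∀ {m l : ℕ} (f : Mag k (m + 1)) (i : Fin (m + 1)) {g : Mag k l},
    g ∈ J l → comp f i g ∈ J (m + l)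

/-- The arity `m` component of the operadic ideal generated by a set `R` of elements of arity `d`:
the intersection of all operadic ideals containing `R`. -/
def operadicIdeal {d : ℕ} (R : Set (Mag k d)) (m : ℕ) : Submodule k (Mag k m) :=
  sInf {I | ∃ J : ∀ m, Submodule k (Mag k m), IsOperadicIdeal J ∧ R ⊆ J d ∧ I = J m}

theorem mem_operadicIdeal {d : ℕ} {R : Set (Mag k d)} {m : ℕ} {f : Mag k m} :
    f ∈ operadicIdeal R m ↔
      ∀ J : ∀ m, Submodule k (Mag k m), IsOperadicIdeal J → R ⊆ J d → f ∈ J m := by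
  simp only [operadicIdeal, Submodule.mem_sInf, Set.mem_ofPred_eq]
  constructor
  · intro h J hJ hR
    exact h _ ⟨J, hJ, hR, rfl⟩
  · rintro h I ⟨J, hJ, hR, rfl⟩
    exact h J hJ hR

theorem isOperadicIdeal_operadicIdeal {d : ℕ} (R : Set (Mag k d)) :
    IsOperadicIdeal (operadicIdeal R) where
  act_mem σ _ hf := mem_operadicIdeal.2 fun J hJ hR =>
    hJ.act_mem σ (mem_operadicIdeal.1 hf J hJ hR)
  comp_mem_of_left i g hf := mem_operadicIdeal.2 fun J hJ hR =>
    hJ.comp_mem_of_left i g (mem_operadicIdeal.1 hf J hJ hR)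
  comp_mem_of_right f i _ hg := mem_operadicIdeal.2 fun J hJ hR =>
    hJ.comp_mem_of_right f i (mem_operadicIdeal.1 hg J hJ hR)

theorem subset_operadicIdeal {d : ℕ} (R : Set (Mag k d)) : R ⊆ operadicIdeal R d :=
  fun _ hf => mem_operadicIdeal.2 fun _ _ hR => hR hf

/-! ### The identities of upper triangular matrices -/

/-- A composition of multiplications: a planar binary tree with leaves bijectively labelled. -/
def monomial (k : Type*) [Field k] {m : ℕ} (t : FreeMagma (Fin m))
    (ht : leaves t = (Finset.univ : Finset (Fin m)).val) : Mag k m :=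
  ⟨MonoidAlgebra.ofMagma k (FreeMagma (Fin m)) t, Submodule.subset_span ⟨t, ht, rfl⟩⟩

/-- The commutator `[x_{2i}, x_{2i+1}]` of two variables (numbered from `0`). -/
def commutator (k : Type*) [Field k] (n : ℕ) (i : Fin n) :
    FreeNonUnitalNonAssocAlgebra k (Fin (2 * n)) :=
  let a := FreeNonUnitalNonAssocAlgebra.of k (⟨2 * i, by omega⟩ : Fin (2 * n))
  let b := FreeNonUnitalNonAssocAlgebra.of k (⟨2 * i + 1, by omega⟩ : Fin (2 * n))
  a * b - b * a

/-- `f([x₁, x₂], [x₃, x₄], …, [x_{2n-1}, x_{2n}])`. -/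
def substCommutators {n : ℕ} (f : Mag k n) : Mag k (2 * n) :=
  ⟨FreeNonUnitalNonAssocAlgebra.lift k (commutator k n) f.1, by
    have hc : ∀ i : Fin n, commutator k n i ∈ homogeneous k
        ({(⟨2 * i, by omega⟩ : Fin (2 * n))} + {(⟨2 * i + 1, by omega⟩ : Fin (2 * n))}) := by
      intro i
      refine sub_mem (mul_mem_homogeneous (of_mem_homogeneous _) (of_mem_homogeneous _)) ?_
      rw [add_comm]
      exact mul_mem_homogeneous (of_mem_homogeneous _) (of_mem_homogeneous _)
    have h := lift_mem_homogeneous hc f.2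
    rwa [eq_univ_val (s := Multiset.bind _ _)] at h
    · intro a
      rw [Multiset.mem_bind]
      refine ⟨⟨a / 2, by omega⟩, by simp, ?_⟩
      simp only [Multiset.mem_add, Multiset.mem_singleton, Fin.ext_iff]
      omega
    · simp
      omega⟩

/-- The identities `f([x₁, x₂], …, [x_{2n-1}, x_{2n}]) = 0`, for every `n`-ary composition `f` of
multiplications. -/
def commutatorIdentities (k : Type*) [Field k] (n : ℕ) : Set (Mag k (2 * n)) :=
  {r | ∃ (t : FreeMagma (Fin n)) (ht : leaves t = (Finset.univ : Finset (Fin n)).val),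
    r = substCommutators (monomial k t ht)}

/-- The arity `m` component of the operad `NU_n`: the quotient of the free operad on one
nonsymmetric binary multiplication by the ideal generated by the identities above. -/
abbrev NU (k : Type*) [Field k] (n m : ℕ) : Type _ :=
  Mag k m ⧸ operadicIdeal (commutatorIdentities k n) m

end MagmaticOperad

/-- The exponential generating series `∑_{m ≥ 1} dim P(m) z^m / m!`. -/
def expGenSeries (k : Type*) [Field k] (P : ℕ → Type*) [∀ m, AddCommGroup (P m)]
    [∀ m, Module k (P m)] : ℚ⟦X⟧ :=
  PowerSeries.mk fun m => if m = 0 then 0 else (Module.finrank k (P m) : ℚ) / m.factorial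

end

/-! In characteristic zero 2 is invertible, so xy is half the sum of the commutator and the
anticommutator of x and y. The free operad is therefore spanned by planar trees whose nodes are
colored by these two operations. In this spanning set the ideal becomes monomial: it is spanned by
the trees having a subtree that is an n-ary composition of commutators
(`operadicIdeal_eq_patternIdeal`). One inclusion holds because these trees span an operadic ideal
containing the identities. The other holds because each such tree comes from an identity by
substitution and further bracketing.

Both operations are symmetric up to sign, so exchanging children matters only up to a scalar. For a
multilinear tree with distinct children s and t at a node, the two orders of s and t are as numerous
as the two colors. Letting the order encode the color (`color`, `toColored`) turns ordinary planar
monomials into a basis adapted to the ideal. Independence follows from counting dimensions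
(`linearIndepOn_eval`). Hence the dimension of NU_n(m) is the number of monomials that avoid the
pattern (`finrank_NU`).

Avoidance is decided by a finite bottom-up automaton, `PatternState`, whose transitions depend only
on the color of a node and the states of its children. The exponential generating series of its
states thus satisfy a finite quadratic system with polynomial coefficients (`stateSeries_eq`). Their
constant terms vanish, so the Jacobian of the system is invertible. Every derivation over the field
of rational functions then kills the solutions, which makes them algebraic
(`PowerSeries.isAlgebraic_of_quadratic_system`). The required series is a finite sum of such
solutions. -/

noncomputable section

namespace MagmaticOperad

/-! ### Colored trees and their evaluations -/

/-- Planar binary trees whose inner nodes carry a color: `true` stands for the commutator and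
`false` for the anticommutator. -/
inductive ColoredTree (X : Type*) where
  | leaf (x : X) : ColoredTree X
  | node (c : Bool) (l r : ColoredTree X) : ColoredTree X

/-- The anticommutator (`c = false`) or the commutator (`c = true`) of two elements. -/
def bracket {k X : Type*} [Field k] (c : Bool) (p q : FreeNonUnitalNonAssocAlgebra k X) :
    FreeNonUnitalNonAssocAlgebra k X :=
  p * q + (if c then -1 else 1 : k) • (q * p)

section bracket

variable {k X Y : Type*} [Field k]

theorem bracket_true (p q : FreeNonUnitalNonAssocAlgebra k X) :
    bracket true p q = p * q - q * p := by
  simp [bracket, sub_eq_add_neg]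

theorem bracket_false (p q : FreeNonUnitalNonAssocAlgebra k X) :
    bracket false p q = p * q + q * p := by
  simp [bracket]

theorem bracket_swap (c : Bool) (p q : FreeNonUnitalNonAssocAlgebra k X) :
    bracket c q p = (if c then -1 else 1 : k) • bracket c p q := by
  cases c <;> simp [bracket_true, bracket_false, add_comm]

theorem bracket_zero_left (c : Bool) (q : FreeNonUnitalNonAssocAlgebra k X) :
    bracket c 0 q = 0 := by
  simp [bracket]

theorem bracket_zero_right (c : Bool) (q : FreeNonUnitalNonAssocAlgebra k X) :
    bracket c q 0 = 0 := by
  simp [bracket]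

theorem bracket_add_left (c : Bool) (p p' q : FreeNonUnitalNonAssocAlgebra k X) :
    bracket c (p + p') q = bracket c p q + bracket c p' q := by
  simp only [bracket, add_mul, mul_add, smul_add]; abel

theorem bracket_add_right (c : Bool) (p q q' : FreeNonUnitalNonAssocAlgebra k X) :
    bracket c p (q + q') = bracket c p q + bracket c p q' := by
  simp only [bracket, add_mul, mul_add, smul_add]; abel

theorem bracket_smul_left (c : Bool) (a : k) (p q : FreeNonUnitalNonAssocAlgebra k X) :
    bracket c (a • p) q = a • bracket c p q := by
  simp only [bracket, smul_mul_assoc, mul_smul_comm, smul_add, smul_comm a]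

theorem bracket_smul_right (c : Bool) (a : k) (p q : FreeNonUnitalNonAssocAlgebra k X) :
    bracket c p (a • q) = a • bracket c p q := by
  simp only [bracket, smul_mul_assoc, mul_smul_comm, smul_add, smul_comm a]

theorem lift_bracket (v : X → FreeNonUnitalNonAssocAlgebra k Y) (c : Bool)
    (p q : FreeNonUnitalNonAssocAlgebra k X) :
    FreeNonUnitalNonAssocAlgebra.lift k v (bracket c p q) =
      bracket c (FreeNonUnitalNonAssocAlgebra.lift k v p)
        (FreeNonUnitalNonAssocAlgebra.lift k v q) := by
  simp only [bracket, map_add, map_smul, map_mul]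

theorem mul_eq_brackets [CharZero k] (p q : FreeNonUnitalNonAssocAlgebra k X) :
    p * q = (2⁻¹ : k) • (bracket true p q + bracket false p q) := by
  rw [bracket_true, bracket_false, sub_add_add_cancel, ← two_smul k, smul_smul,
    inv_mul_cancel₀ two_ne_zero, one_smul]

theorem bracket_mem_homogeneous (c : Bool) {S T : Multiset X}
    {p q : FreeNonUnitalNonAssocAlgebra k X} (hp : p ∈ homogeneous k S)
    (hq : q ∈ homogeneous k T) : bracket c p q ∈ homogeneous k (S + T) :=
  add_mem (mul_mem_homogeneous hp hq)
    (Submodule.smul_mem _ _ (add_comm T S ▸ mul_mem_homogeneous hq hp))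

theorem lift_lift {Z : Type*} (v : X → FreeNonUnitalNonAssocAlgebra k Y)
    (w : Y → FreeNonUnitalNonAssocAlgebra k Z) (p : FreeNonUnitalNonAssocAlgebra k X) :
    FreeNonUnitalNonAssocAlgebra.lift k w (FreeNonUnitalNonAssocAlgebra.lift k v p) =
      FreeNonUnitalNonAssocAlgebra.lift k
        (fun x => FreeNonUnitalNonAssocAlgebra.lift k w (v x)) p := by
  have : (FreeNonUnitalNonAssocAlgebra.lift k w).comp (FreeNonUnitalNonAssocAlgebra.lift k v) =
      FreeNonUnitalNonAssocAlgebra.lift k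
        (fun x => FreeNonUnitalNonAssocAlgebra.lift k w (v x)) := by
    apply FreeNonUnitalNonAssocAlgebra.hom_ext
    intro x
    simp [FreeNonUnitalNonAssocAlgebra.lift_of_apply]
  exact DFunLike.congr_fun this p

end bracket

/-- The states by which an automaton reading a colored tree `T` looks for forbidden patterns.
The first component is the set of the `a ≤ n` such that `T` is an `a`-ary composition of
commutators, the second one says whether `n` has occurred at some node. -/
abbrev PatternState (n : ℕ) : Type := Set (Fin (n + 1)) × Prop

namespace PatternState

/-- The state at a node of color `c` with the states `s` and `t` at its children. -/
def step {n : ℕ} (c : Bool) (s t : PatternState n) : PatternState n :=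
  let u : Set (Fin (n + 1)) :=
    {i | (c = true ∧ (i : ℕ) = 1) ∨ ∃ a ∈ s.1, ∃ b ∈ t.1, (a : ℕ) + b = i}
  (u, Fin.last n ∈ u ∨ s.2 ∨ t.2)

theorem step_comm {n : ℕ} (c : Bool) (s t : PatternState n) : step c s t = step c t s := by
  have h : {i : Fin (n + 1) | (c = true ∧ (i : ℕ) = 1) ∨ ∃ a ∈ s.1, ∃ b ∈ t.1, (a : ℕ) + b = i} =
      {i : Fin (n + 1) | (c = true ∧ (i : ℕ) = 1) ∨ ∃ a ∈ t.1, ∃ b ∈ s.1, (a : ℕ) + b = i} := by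
    ext i
    refine or_congr_right ⟨?_, ?_⟩
    all_goals
      rintro ⟨a, ha, b, hb, h⟩
      exact ⟨b, hb, a, ha, by omega⟩
  simp only [step, h, or_comm (a := s.2)]

theorem step_mono {n : ℕ} (c : Bool) {s s' t t' : PatternState n} (hs : s ≤ s') (ht : t ≤ t') :
    step c s t ≤ step c s' t' := by
  have h : ∀ i : Fin (n + 1), i ∈ (step c s t).1 → i ∈ (step c s' t').1 := by
    rintro i (h | ⟨a, ha, b, hb, h⟩)
    · exact Or.inl h
    · exact Or.inr ⟨a, hs.1 ha, b, ht.1 hb, h⟩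
  refine ⟨h, ?_⟩
  rintro (h' | h' | h')
  · exact Or.inl (h _ h')
  · exact Or.inr (Or.inl (hs.2 h'))
  · exact Or.inr (Or.inr (ht.2 h'))

end PatternState

/-! ### Grafting of colored trees and propagation of states -/

namespace ColoredTree

variable {X Y Z : Type*}

/-- The multiset of the labels of the leaves. -/
def leaves : ColoredTree X → Multiset X
  | leaf x => {x}
  | node _ l r => l.leaves + r.leaves

/-- Grafting of trees at the leaves. -/
def bind (C : X → ColoredTree Y) : ColoredTree X → ColoredTree Y
  | leaf x => C x
  | node c l r => node c (l.bind C) (r.bind C)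

/-- The element of the free nonassociative algebra given by a colored tree. -/
def eval (k : Type*) [Field k] : ColoredTree X → FreeNonUnitalNonAssocAlgebra k X
  | leaf x => FreeNonUnitalNonAssocAlgebra.of k x
  | node c l r => bracket c (l.eval k) (r.eval k)

/-- The state at the root, when the states at the leaves are given. -/
def state {n : ℕ} (ι : X → PatternState n) : ColoredTree X → PatternState n
  | leaf x => ι x
  | node c l r => PatternState.step c (l.state ι) (r.state ι)

theorem leaves_bind (C : X → ColoredTree Y) (T : ColoredTree X) :
    (T.bind C).leaves = T.leaves.bind fun x => (C x).leaves := by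
  induction T with
  | leaf x => simp [bind, leaves]
  | node c l r hl hr => simp only [bind, leaves, hl, hr, Multiset.add_bind]

theorem state_bind {n : ℕ} (ι : Y → PatternState n) (C : X → ColoredTree Y) (T : ColoredTree X) :
    (T.bind C).state ι = T.state fun x => (C x).state ι := by
  induction T with
  | leaf x => rfl
  | node c l r hl hr => simp only [bind, state, hl, hr]

theorem bind_bind (C : X → ColoredTree Y) (D : Y → ColoredTree Z) (T : ColoredTree X) :
    (T.bind C).bind D = T.bind fun x => (C x).bind D := by
  induction T with
  | leaf x => rfl
  | node c l r hl hr => simp only [bind, hl, hr]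

theorem lift_eval {k : Type*} [Field k] (C : X → ColoredTree Y) (T : ColoredTree X) :
    FreeNonUnitalNonAssocAlgebra.lift k (fun x => (C x).eval k) (T.eval k) =
      (T.bind C).eval k := by
  induction T with
  | leaf x => simp [bind, eval, FreeNonUnitalNonAssocAlgebra.lift_of_apply]
  | node c l r hl hr => simp only [bind, eval, lift_bracket, hl, hr]

theorem eval_mem_homogeneous (k : Type*) [Field k] (T : ColoredTree X) :
    T.eval k ∈ homogeneous k T.leaves := by
  induction T with
  | leaf x => exact of_mem_homogeneous x
  | node c l r hl hr => exact bracket_mem_homogeneous c hl hr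

theorem state_snd_of_mem_leaves {n : ℕ} {ι : X → PatternState n} {T : ColoredTree X} {x : X}
    (hx : x ∈ T.leaves) (h : (ι x).2) : (T.state ι).2 := by
  induction T with
  | leaf y =>
    obtain rfl : x = y := by simpa [leaves] using hx
    exact h
  | node c l r hl hr =>
    rcases Multiset.mem_add.1 hx with hx | hx
    · exact Or.inr (Or.inl (hl hx))
    · exact Or.inr (Or.inr (hr hx))

/-- Leaf counts add at a node exactly as the entries of the states do. Applied when every leaf is to
be replaced by a commutator, whose state contains 1. -/
theorem mem_state_of_card_leaves {n : ℕ} {ι : X → PatternState n} {T : ColoredTree X}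
    (h : ∀ x, ∀ i : Fin (n + 1), (i : ℕ) = 1 → i ∈ (ι x).1) {i : Fin (n + 1)}
    (hi : Multiset.card T.leaves = i) : i ∈ (T.state ι).1 := by
  induction T generalizing i with
  | leaf x => exact h x i (by rw [← hi]; simp [leaves])
  | node c l r hl hr =>
    have hi' : Multiset.card l.leaves + Multiset.card r.leaves = i := by
      rw [← hi, leaves, Multiset.card_add]
    have hlt : Multiset.card l.leaves < n + 1 := by omega
    have hrt : Multiset.card r.leaves < n + 1 := by omega
    exact Or.inr ⟨⟨_, hlt⟩, hl (i := ⟨_, hlt⟩) rfl, ⟨_, hrt⟩, hr (i := ⟨_, hrt⟩) rfl, hi'⟩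

theorem snd_state_of_mem {n : ℕ} {ι : X → PatternState n} {T : ColoredTree X}
    (h : ∀ x, Fin.last n ∈ (ι x).1 → (ι x).2) (hT : Fin.last n ∈ (T.state ι).1) :
    (T.state ι).2 := by
  cases T with
  | leaf x => exact h x hT
  | node c l r => exact Or.inl hT

end ColoredTree

/-! ### The spans of the evaluations of the trees with given states -/

/-- The span of the evaluations of the colored trees with leaves `S` and a state above `s`. -/
def stateSpan (k : Type*) [Field k] {X : Type*} {n : ℕ} (S : Multiset X) (s : PatternState n) :
    Submodule k (FreeNonUnitalNonAssocAlgebra k X) :=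
  Submodule.span k (ColoredTree.eval k '' {T | T.leaves = S ∧ s ≤ T.state ⊥})

section stateSpan

variable {k X Y : Type*} [Field k] {n : ℕ}

theorem bracket_mem_stateSpan (c : Bool) {S T : Multiset X} {s t : PatternState n}
    {p q : FreeNonUnitalNonAssocAlgebra k X} (hp : p ∈ stateSpan k S s)
    (hq : q ∈ stateSpan k T t) : bracket c p q ∈ stateSpan k (S + T) (PatternState.step c s t) := by
  induction hp using Submodule.span_induction with
  | zero => rw [bracket_zero_left]; exact zero_mem _
  | add x y _ _ hx hy => rw [bracket_add_left]; exact add_mem hx hy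
  | smul a x _ hx => rw [bracket_smul_left]; exact Submodule.smul_mem _ _ hx
  | mem x hx =>
    obtain ⟨u, ⟨hu, hu'⟩, rfl⟩ := hx
    induction hq using Submodule.span_induction with
    | zero => rw [bracket_zero_right]; exact zero_mem _
    | add x y _ _ hx hy => rw [bracket_add_right]; exact add_mem hx hy
    | smul a x _ hx => rw [bracket_smul_right]; exact Submodule.smul_mem _ _ hx
    | mem y hy =>
      obtain ⟨v, ⟨hv, hv'⟩, rfl⟩ := hy
      exact Submodule.subset_span ⟨.node c u v, ⟨by rw [ColoredTree.leaves, hu, hv],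
        PatternState.step_mono c hu' hv'⟩, rfl⟩

theorem stateSpan_anti (S : Multiset X) {s t : PatternState n} (h : s ≤ t) :
    stateSpan k S t ≤ stateSpan k S s :=
  Submodule.span_mono (Set.image_mono fun _ hT => ⟨hT.1, h.trans hT.2⟩)

theorem lift_eval_mem_stateSpan {B : X → Multiset Y} {ι : X → PatternState n}
    {v : X → FreeNonUnitalNonAssocAlgebra k Y} (hv : ∀ x, v x ∈ stateSpan k (B x) (ι x))
    (T : ColoredTree X) : FreeNonUnitalNonAssocAlgebra.lift k v (T.eval k) ∈
      stateSpan k (T.leaves.bind B) (T.state ι) := by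
  induction T with
  | leaf x =>
    simpa [ColoredTree.eval, ColoredTree.leaves, ColoredTree.state,
      FreeNonUnitalNonAssocAlgebra.lift_of_apply] using hv x
  | node c l r hl hr =>
    simp only [ColoredTree.eval, ColoredTree.leaves, ColoredTree.state, lift_bracket,
      Multiset.add_bind]
    exact bracket_mem_stateSpan c hl hr

theorem stateSpan_le_homogeneous (S : Multiset X) (s : PatternState n) :
    stateSpan k S s ≤ homogeneous k S := by
  refine Submodule.span_le.2 ?_
  rintro _ ⟨T, ⟨rfl, _⟩, rfl⟩
  exact T.eval_mem_homogeneous k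

/-- Expanding each product into commutator and anticommutator writes a monomial through colored
trees; this is where 2 has to be invertible. -/
theorem stateSpan_bot [CharZero k] (S : Multiset X) :
    stateSpan k S (⊥ : PatternState n) = homogeneous k S := by
  refine le_antisymm (stateSpan_le_homogeneous S _) (Submodule.span_le.2 ?_)
  rintro _ ⟨t, rfl, rfl⟩
  induction t with
  | ih1 x => exact Submodule.subset_span ⟨.leaf x, ⟨rfl, bot_le⟩, rfl⟩
  | ih2 s t hs ht =>
    rw [map_mul, SetLike.mem_coe, mul_eq_brackets]
    exact Submodule.smul_mem _ _ (add_mem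
      (stateSpan_anti _ bot_le (bracket_mem_stateSpan true hs ht))
      (stateSpan_anti _ bot_le (bracket_mem_stateSpan false hs ht)))

/-! ### Trees with a forbidden pattern form an ideal containing the identities -/

/-- The multilinear elements spanned by the evaluations of the trees with a forbidden pattern. -/
def patternIdeal (k : Type*) [Field k] (n m : ℕ) : Submodule k (Mag k m) :=
  (stateSpan k (Finset.univ : Finset (Fin m)).val
    ((∅, True) : PatternState n)).comap (Mag k m).subtype

theorem le_state_iff {T : ColoredTree X} :
    ((∅, True) : PatternState n) ≤ T.state ⊥ ↔ (T.state (⊥ : X → PatternState n)).2 :=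
  ⟨fun h => h.2 trivial, fun h => ⟨Set.empty_subset _, fun _ => h⟩⟩

/-- Grafting at the leaves of a tree can only enlarge its state, since `PatternState.step` is
monotone and leaves carry the least state. -/
theorem lift_mem_stateSpan_of_forall [CharZero k] {B : X → Multiset Y}
    {v : X → FreeNonUnitalNonAssocAlgebra k Y} (hv : ∀ x, v x ∈ homogeneous k (B x))
    {S : Multiset X} {p : FreeNonUnitalNonAssocAlgebra k X}
    (hp : p ∈ stateSpan k S ((∅, True) : PatternState n)) :
    FreeNonUnitalNonAssocAlgebra.lift k v p ∈
      stateSpan k (S.bind B) ((∅, True) : PatternState n) := by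
  induction hp using Submodule.span_induction with
  | zero => rw [map_zero]; exact zero_mem _
  | add x y _ _ hx hy => rw [map_add]; exact add_mem hx hy
  | smul a x _ hx => rw [map_smul]; exact Submodule.smul_mem _ _ hx
  | mem x hx =>
    obtain ⟨T, ⟨rfl, hT⟩, rfl⟩ := hx
    exact stateSpan_anti _ hT (lift_eval_mem_stateSpan (ι := ⊥)
      (fun x => by rw [Pi.bot_apply, stateSpan_bot]; exact hv x) T)

/-- A pattern inside the tree grafted at one leaf is remembered by the second component of every
state up to the root. -/
theorem lift_mem_stateSpan_of_mem [CharZero k] {B : X → Multiset Y}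
    {v : X → FreeNonUnitalNonAssocAlgebra k Y} (hv : ∀ x, v x ∈ homogeneous k (B x))
    {S : Multiset X} {x : X} (hx : x ∈ S)
    (hvx : v x ∈ stateSpan k (B x) ((∅, True) : PatternState n))
    {p : FreeNonUnitalNonAssocAlgebra k X} (hp : p ∈ homogeneous k S) :
    FreeNonUnitalNonAssocAlgebra.lift k v p ∈
      stateSpan k (S.bind B) ((∅, True) : PatternState n) := by
  classical
  rw [← stateSpan_bot (n := n)] at hp
  induction hp using Submodule.span_induction with
  | zero => rw [map_zero]; exact zero_mem _
  | add x y _ _ hx hy => rw [map_add]; exact add_mem hx hy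
  | smul a x _ hx => rw [map_smul]; exact Submodule.smul_mem _ _ hx
  | mem p hp =>
    obtain ⟨T, ⟨rfl, hT⟩, rfl⟩ := hp
    -- Only the leaf `x` is known to receive a pattern; nothing is assumed about what is grafted at
    -- the others.
    refine stateSpan_anti _ ?_ (lift_eval_mem_stateSpan
      (ι := Function.update ⊥ x ((∅, True) : PatternState n)) (fun y => ?_) T)
    · refine ⟨Set.empty_subset _, fun _ => ColoredTree.state_snd_of_mem_leaves hx ?_⟩
      simp
    · by_cases h : y = x
      · subst h; simpa using hvx
      · rw [Function.update_of_ne h, Pi.bot_apply, stateSpan_bot]; exact hv y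

theorem isOperadicIdeal_patternIdeal [CharZero k] : IsOperadicIdeal (patternIdeal k n) where
  act_mem {m} σ f hf := by
    have h := lift_mem_stateSpan_of_forall (n := n) (B := fun i => {σ i})
      (fun i => of_mem_homogeneous (k := k) (σ i)) hf
    rw [eq_univ_val (s := Multiset.bind _ _)] at h
    · exact h
    · intro a
      simp only [Multiset.mem_bind, Multiset.mem_singleton]
      exact ⟨σ.symm a, by simp, by simp⟩
    · simp
  comp_mem_of_left {m l f} i g hf := by
    have h := lift_mem_stateSpan_of_forall (n := n) (compSubst_mem i g) hf
    rwa [bind_compLeaves] at h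
  comp_mem_of_right {m l} f i {g} hg := by
    have h := lift_mem_stateSpan_of_mem (n := n) (compSubst_mem i g)
      (S := Finset.univ.val) (x := i) (by simp) ?_ f.2
    · rwa [bind_compLeaves] at h
    · have h := lift_mem_stateSpan_of_forall (n := n)
        (fun b : Fin l => of_mem_homogeneous (k := k) (⟨i + b, by omega⟩ : Fin (m + l))) hg
      simpa [compSubst, compLeaves] using h

/-- Expand f into colored trees with n leaves. Replacing each leaf by a commutator gives n-ary
compositions of commutators, so n occurs in the state of the root. -/
theorem commutatorIdentities_subset_patternIdeal [CharZero k] :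
    commutatorIdentities k n ⊆ patternIdeal k n (2 * n) := by
  rintro _ ⟨t, ht, rfl⟩
  let C : Fin n → ColoredTree (Fin (2 * n)) := fun i =>
    .node true (.leaf ⟨2 * i, by omega⟩) (.leaf ⟨2 * i + 1, by omega⟩)
  have hC : commutator k n = fun i => (C i).eval k := by
    ext1 i
    simp only [C, ColoredTree.eval, bracket_true, commutator]
  have hv : ∀ x, (C x).eval k ∈ stateSpan k (C x).leaves
      (PatternState.step true ⊥ ⊥ : PatternState n) :=
    fun x => Submodule.subset_span ⟨C x, ⟨rfl, le_rfl⟩, rfl⟩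
  have hmem := (substCommutators (monomial k t ht)).2
  have key : ∀ p ∈ stateSpan k (Finset.univ : Finset (Fin n)).val (⊥ : PatternState n),
      FreeNonUnitalNonAssocAlgebra.lift k (commutator k n) p ∈
        stateSpan k (Finset.univ : Finset (Fin (2 * n))).val ((∅, True) : PatternState n) := by
    intro p hp
    induction hp using Submodule.span_induction with
    | zero => rw [map_zero]; exact zero_mem _
    | add x y _ _ hx hy => rw [map_add]; exact add_mem hx hy
    | smul a x _ hx => rw [map_smul]; exact Submodule.smul_mem _ _ hx
    | mem p hp =>
      obtain ⟨T, ⟨hT, -⟩, rfl⟩ := hp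
      rw [hC, ColoredTree.lift_eval]
      refine Submodule.subset_span ⟨_, ⟨?_, ?_⟩, rfl⟩
      · rw [ColoredTree.leaves_bind, hT]
        refine eq_univ_val (fun a => ?_) ?_
        · rw [Multiset.mem_bind]
          refine ⟨⟨a / 2, by omega⟩, by simp, ?_⟩
          simp only [C, ColoredTree.leaves, Multiset.mem_add, Multiset.mem_singleton, Fin.ext_iff]
          omega
        · simp [C, ColoredTree.leaves]
          omega
      · rw [le_state_iff, ColoredTree.state_bind]
        -- Each `C x` is itself a node, so an occurrence of n in its first component is recorded in
        -- the second; this covers a tree that is a single leaf.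
        refine ColoredTree.snd_state_of_mem (fun x hx => Or.inl hx) ?_
        refine ColoredTree.mem_state_of_card_leaves
          (ι := fun x => (C x).state (⊥ : Fin (2 * n) → PatternState n))
          (fun x i hi => Or.inl ⟨rfl, hi⟩) ?_
        simp [hT]
  exact key _ (stateSpan_bot (k := k) (n := n) _ ▸ (monomial k t ht).2)

theorem operadicIdeal_le_patternIdeal [CharZero k] (m : ℕ) :
    operadicIdeal (commutatorIdentities k n) m ≤ patternIdeal k n m := fun _ hf =>
  mem_operadicIdeal.1 hf _ isOperadicIdeal_patternIdeal commutatorIdentities_subset_patternIdeal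

end stateSpan

/-! ### The forbidden patterns lie in the ideal generated by the identities -/

namespace ColoredTree

variable {X : Type*}

/-- Every tree is obtained by renaming the leaves of a multilinear one. -/
theorem exists_multilinear (T : ColoredTree X) :
    ∃ (l : ℕ) (T' : ColoredTree (Fin l)) (κ : Fin l → X), Multiset.card T.leaves = l ∧
      T'.leaves = (Finset.univ : Finset (Fin l)).val ∧ T'.bind (fun i => leaf (κ i)) = T := by
  induction T with
  | leaf x => exact ⟨1, leaf 0, fun _ => x, rfl, rfl, rfl⟩
  | node c l r hl hr =>
    obtain ⟨a, l', κ, ha, hl', rfl⟩ := hl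
    obtain ⟨b, r', μ, hb, hr', rfl⟩ := hr
    refine ⟨a + b, node c (l'.bind fun i => leaf (Fin.castAdd b i))
      (r'.bind fun i => leaf (Fin.natAdd a i)), Fin.append κ μ, ?_, ?_, ?_⟩
    · rw [leaves, Multiset.card_add, ha, hb]
    · simp only [leaves, leaves_bind, hl', hr']
      refine eq_univ_val (fun i => ?_) (by simp)
      rw [Multiset.mem_add]
      induction i using Fin.addCases with
      | left i => left; simp
      | right i => right; simp
    · simp only [bind, bind_bind, Fin.append_left, Fin.append_right]

/-- The meaning of the states: decompositions into a composition of commutators. -/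
theorem exists_bind_of_mem_state {n : ℕ} {T : ColoredTree X} {a : Fin (n + 1)}
    (ha : a ∈ (T.state (⊥ : X → PatternState n)).1) :
    ∃ F : ColoredTree (ColoredTree X × ColoredTree X), Multiset.card F.leaves = a ∧
      F.bind (fun P => node true P.1 P.2) = T := by
  induction T generalizing a with
  | leaf x => exact absurd ha (Set.notMem_empty a)
  | node c l r hl hr =>
    rcases ha with ⟨rfl, h⟩ | ⟨i, hi, j, hj, h⟩
    · exact ⟨leaf (l, r), by rw [h]; rfl, rfl⟩
    · obtain ⟨F, hF, rfl⟩ := hl hi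
      obtain ⟨G, hG, rfl⟩ := hr hj
      exact ⟨node c F G, by rw [leaves, Multiset.card_add, hF, hG, h], rfl⟩

end ColoredTree

/-! ### Stability of operadic ideals under substitution and bracketing -/

section

variable {k X Y : Type*} [Field k]

theorem leaves_eq_of_mem_homogeneous {S : Multiset X} {p : FreeNonUnitalNonAssocAlgebra k X}
    (hp : p ∈ homogeneous k S) (t : FreeMagma X) (ht : p.coeff t ≠ 0) : leaves t = S := by
  classical
  by_contra hS
  refine ht ?_
  clear ht
  induction hp using Submodule.span_induction with
  | zero => rfl
  | add x y _ _ hx hy => rw [MonoidAlgebra.coeff_add, Finsupp.add_apply, hx, hy, add_zero]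
  | smul a x _ hx => rw [MonoidAlgebra.coeff_smul, Finsupp.smul_apply, hx, smul_zero]
  | mem x hx =>
    obtain ⟨s, rfl, rfl⟩ := hx
    have hst : s ≠ t := by rintro rfl; exact hS rfl
    simp [MonoidAlgebra.ofMagma, hst]

/-- Monomials are independent, so any monomial with nonzero coefficient determines the multidegree.
-/
theorem eq_of_mem_homogeneous {S T : Multiset X} {p : FreeNonUnitalNonAssocAlgebra k X}
    (hS : p ∈ homogeneous k S) (hT : p ∈ homogeneous k T) (hp : p ≠ 0) : S = T := by
  by_contra h
  refine hp (MonoidAlgebra.ext (Finsupp.ext fun t => ?_))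
  by_contra ht
  exact h ((leaves_eq_of_mem_homogeneous hS t ht).symm.trans (leaves_eq_of_mem_homogeneous hT t ht))

/-- A nonassociative polynomial obtained by renaming the variables of an element of `J`. -/
def IsRenaming (J : ∀ m, Submodule k (Mag k m)) (p : FreeNonUnitalNonAssocAlgebra k X) : Prop :=
  ∃ (m : ℕ) (ι : Fin m → X), ∃ g ∈ J m,
    FreeNonUnitalNonAssocAlgebra.lift k
      (fun i => FreeNonUnitalNonAssocAlgebra.of k (ι i)) g.1 = p

/-- The multilinear element given by a multilinear colored tree. -/
def evalMag (k : Type*) [Field k] {m : ℕ} (T : ColoredTree (Fin m))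
    (hT : T.leaves = (Finset.univ : Finset (Fin m)).val) : Mag k m :=
  ⟨T.eval k, by rw [Mag, ← hT]; exact T.eval_mem_homogeneous k⟩

variable {J : ∀ m, Submodule k (Mag k m)}

theorem IsRenaming.smul {p : FreeNonUnitalNonAssocAlgebra k X} (hp : IsRenaming J p) (a : k) :
    IsRenaming J (a • p) := by
  obtain ⟨m, ι, g, hg, rfl⟩ := hp
  exact ⟨m, ι, a • g, Submodule.smul_mem _ _ hg, map_smul _ _ _⟩

/-- Partial composition fills one input at a time with a multilinear element. The inputs are treated
from the last to the first: composing at input `r` leaves the smaller inputs in place and creates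
new inputs only at positions at least `r`. Repeated variables are restored by the final renaming. -/
theorem isRenaming_lift_of_forall_ge (hJ : IsOperadicIdeal J) (r : ℕ) {m : ℕ} {g : Mag k m}
    (hg : g ∈ J m) (C : Fin m → ColoredTree X)
    (hC : ∀ i : Fin m, r ≤ i → ∃ x, C i = ColoredTree.leaf x) :
    IsRenaming J (FreeNonUnitalNonAssocAlgebra.lift k (fun i => (C i).eval k) g.1) := by
  induction r generalizing m with
  | zero =>
    choose ι hι using fun i => hC i (Nat.zero_le _)
    exact ⟨m, ι, g, hg, by simp only [hι, ColoredTree.eval]⟩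
  | succ r ih =>
    by_cases hr : m ≤ r
    · exact ih hg C fun i hi => absurd i.2 (by omega)
    obtain ⟨m, rfl⟩ : ∃ m', m = m' + 1 := ⟨m - 1, by omega⟩
    obtain ⟨l, T, κ, -, hT, hTC⟩ := (C ⟨r, by omega⟩).exists_multilinear
    -- After the composition, positions `r` to `r + l - 1` hold the inputs of `T`, and later inputs
    -- of `g` are shifted by `l - 1`.
    let C' : Fin (m + l) → ColoredTree X := fun j =>
      if h1 : (j : ℕ) < r then C ⟨j, by omega⟩
      else if h2 : (j : ℕ) < r + l then ColoredTree.leaf (κ ⟨j - r, by omega⟩)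
      else C ⟨j + 1 - l, by omega⟩
    have h := ih (hJ.comp_mem_of_left ⟨r, by omega⟩ (evalMag k T hT) hg) C' ?_
    · convert h using 1
      change _ = FreeNonUnitalNonAssocAlgebra.lift k (fun i => (C' i).eval k)
        (FreeNonUnitalNonAssocAlgebra.lift k (compSubst ⟨r, by omega⟩ (T.eval k)) g.1)
      rw [lift_lift]
      congr 2
      ext1 j
      unfold compSubst
      split_ifs with h1 h2
      · have h1' : (j : ℕ) < r := h1
        simp [FreeNonUnitalNonAssocAlgebra.lift_of_apply, C', h1']
      · subst h2
        rw [lift_lift, ← hTC, ← ColoredTree.lift_eval]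
        congr 2
        ext1 b
        simp [FreeNonUnitalNonAssocAlgebra.lift_of_apply, C', ColoredTree.eval]
      · have h1' : ¬ (j : ℕ) < r := h1
        have h2' : (j : ℕ) ≠ r := fun h => h2 (Fin.ext h)
        have h3 : ¬ (j + l - 1 : ℕ) < r := by omega
        have h4 : ¬ (j + l - 1 : ℕ) < r + l := by omega
        have h5 : (j + l - 1 + 1 - l : ℕ) = j := by omega
        simp [FreeNonUnitalNonAssocAlgebra.lift_of_apply, C', h3, h4, h5]
    · intro i hi
      by_cases h2 : (i : ℕ) < r + l
      · exact ⟨_, by simp only [C', not_lt.2 hi, h2, dite_true, dite_false]; rfl⟩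
      · obtain ⟨x, hx⟩ := hC ⟨i + 1 - l, by omega⟩ (by simp only; omega)
        exact ⟨x, by simp only [C', not_lt.2 hi, h2, dite_false]; exact hx⟩

/-- An operadic ideal is stable under all substitutions. -/
theorem isRenaming_lift (hJ : IsOperadicIdeal J) {m : ℕ} {g : Mag k m} (hg : g ∈ J m)
    (C : Fin m → ColoredTree X) :
    IsRenaming J (FreeNonUnitalNonAssocAlgebra.lift k (fun i => (C i).eval k) g.1) :=
  isRenaming_lift_of_forall_ge hJ m hg C fun i hi => absurd i.2 (by omega)

/-- Compose the two-leaf tree with `g` at its first input, then substitute `U` for the last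
variable. -/
theorem IsRenaming.bracket_left (hJ : IsOperadicIdeal J)
    {p : FreeNonUnitalNonAssocAlgebra k X} (hp : IsRenaming J p) (c : Bool) (U : ColoredTree X) :
    IsRenaming J (bracket c p (U.eval k)) := by
  obtain ⟨l, ι, g, hg, rfl⟩ := hp
  let T : ColoredTree (Fin (1 + 1)) := .node c (.leaf 0) (.leaf 1)
  have hT : T.leaves = (Finset.univ : Finset (Fin (1 + 1))).val := rfl
  let C : Fin (1 + l) → ColoredTree X := fun j =>
    if h : (j : ℕ) < l then ColoredTree.leaf (ι ⟨j, h⟩) else U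
  have h := isRenaming_lift hJ (hJ.comp_mem_of_right (evalMag k T hT) 0 hg) C
  convert h using 1
  change _ = FreeNonUnitalNonAssocAlgebra.lift k (fun i => (C i).eval k)
    (FreeNonUnitalNonAssocAlgebra.lift k (compSubst 0 g.1) (T.eval k))
  rw [lift_lift]
  simp only [T, ColoredTree.eval, lift_bracket, FreeNonUnitalNonAssocAlgebra.lift_of_apply]
  congr 1
  · simp [compSubst, lift_lift, FreeNonUnitalNonAssocAlgebra.lift_of_apply, C, ColoredTree.eval]
  · simp [compSubst, FreeNonUnitalNonAssocAlgebra.lift_of_apply, C]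

theorem IsRenaming.bracket_right (hJ : IsOperadicIdeal J)
    {p : FreeNonUnitalNonAssocAlgebra k X} (hp : IsRenaming J p) (c : Bool) (U : ColoredTree X) :
    IsRenaming J (bracket c (U.eval k) p) := by
  rw [bracket_swap]
  exact (hp.bracket_left hJ c U).smul _

/-- The identities are imposed for monomials only; linearity extends them to all multilinear f, in
particular to evaluated colored trees. -/
theorem substCommutators_mem {n : ℕ} {I : Submodule k (Mag k (2 * n))}
    (hI : commutatorIdentities k n ⊆ I) (f : Mag k n) : substCommutators f ∈ I := by
  have key : ∀ p ∈ homogeneous k (Finset.univ : Finset (Fin n)).val,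
      FreeNonUnitalNonAssocAlgebra.lift k (commutator k n) p ∈
        I.map (Mag k (2 * n)).subtype := by
    intro p hp
    induction hp using Submodule.span_induction with
    | zero => rw [map_zero]; exact zero_mem _
    | add x y _ _ hx hy => rw [map_add]; exact add_mem hx hy
    | smul a x _ hx => rw [map_smul]; exact Submodule.smul_mem _ a hx
    | mem p hp =>
      obtain ⟨t, ht, rfl⟩ := hp
      exact ⟨_, hI ⟨t, ht, rfl⟩, rfl⟩
  obtain ⟨g, hg, h⟩ := key f.1 f.2
  rwa [← show g = substCommutators f from Subtype.ext h]

/-- The state provides an n-leaf tree `F` whose leaves are pairs of arguments of commutators. Its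
multilinear version yields an identity, into which these pairs are substituted. -/
theorem isRenaming_of_last_mem_state {n : ℕ} (hJ : IsOperadicIdeal J)
    (hR : commutatorIdentities k n ⊆ J (2 * n)) {T : ColoredTree X}
    (hT : Fin.last n ∈ (T.state (⊥ : X → PatternState n)).1) : IsRenaming J (T.eval k) := by
  obtain ⟨F, hF, rfl⟩ := ColoredTree.exists_bind_of_mem_state hT
  obtain ⟨l, F', κ, hl, hF', rfl⟩ := F.exists_multilinear
  obtain rfl : l = n := hl.symm.trans hF
  have h := isRenaming_lift hJ (substCommutators_mem hR (evalMag k F' hF'))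
    -- Inputs `2i` and `2i + 1` of the identity are the two arguments of its `i`-th commutator.
    fun j : Fin (2 * l) => if (j : ℕ) % 2 = 0 then (κ ⟨j / 2, by omega⟩).1
      else (κ ⟨j / 2, by omega⟩).2
  convert h using 1
  change _ = FreeNonUnitalNonAssocAlgebra.lift k _
    (FreeNonUnitalNonAssocAlgebra.lift k (commutator k l) (F'.eval k))
  rw [lift_lift, ColoredTree.bind_bind, ← ColoredTree.lift_eval]
  congr 2
  ext1 i
  have h1 : (2 * (i : ℕ) + 1) / 2 = i := by omega
  simp [commutator, FreeNonUnitalNonAssocAlgebra.lift_of_apply, ColoredTree.bind,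
    ColoredTree.eval, bracket_true, h1, Nat.add_mod]

theorem isRenaming_of_state {n : ℕ} (hJ : IsOperadicIdeal J)
    (hR : commutatorIdentities k n ⊆ J (2 * n)) {T : ColoredTree X}
    (hT : (T.state (⊥ : X → PatternState n)).2) : IsRenaming J (T.eval k) := by
  induction T with
  | leaf x => exact hT.elim
  | node c l r hl hr =>
    rcases hT with h | h | h
    · exact isRenaming_of_last_mem_state hJ hR h
    · exact (hl h).bracket_left hJ c r
    · exact (hr h).bracket_right hJ c l

/-- A nonzero multilinear result has every variable exactly once, which forces the renaming to be a
permutation. -/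
theorem mem_of_isRenaming (hJ : IsOperadicIdeal J) {m : ℕ} {f : Mag k m}
    (hf : IsRenaming J f.1) : f ∈ J m := by
  by_cases h0 : f.1 = 0
  · obtain rfl : f = 0 := Subtype.ext h0
    exact zero_mem _
  obtain ⟨l, ι, g, hg, h⟩ := hf
  have hS := lift_mem_homogeneous (fun i => of_mem_homogeneous (k := k) (ι i)) g.2
  rw [h] at hS
  have hS := eq_of_mem_homogeneous hS f.2 h0
  rw [Multiset.bind_singleton] at hS
  obtain rfl : l = m := by simpa using congrArg Multiset.card hS
  have hsurj : Function.Surjective ι := fun a => by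
    have : a ∈ Multiset.map ι Finset.univ.val := by rw [hS]; simp
    simpa using this
  let σ := Equiv.ofBijective ι (Finite.surjective_iff_bijective.1 hsurj)
  convert hJ.act_mem σ hg using 1
  exact Subtype.ext h.symm

theorem patternIdeal_le_operadicIdeal (n m : ℕ) :
    patternIdeal k n m ≤ operadicIdeal (commutatorIdentities k n) m := by
  intro f hf
  change f.1 ∈ stateSpan k _ _ at hf
  refine mem_operadicIdeal.2 fun J hJ hR => ?_
  have key : stateSpan k (Finset.univ : Finset (Fin m)).val ((∅, True) : PatternState n) ≤
      (J m).map (Mag k m).subtype := by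
    refine Submodule.span_le.2 ?_
    rintro _ ⟨T, ⟨hT, hT'⟩, rfl⟩
    exact ⟨evalMag k T hT,
      mem_of_isRenaming hJ (isRenaming_of_state hJ hR (le_state_iff.1 hT')), rfl⟩
  obtain ⟨g, hg, h⟩ := key hf
  rwa [← show g = f from Subtype.ext h]

theorem operadicIdeal_eq_patternIdeal [CharZero k] (n m : ℕ) :
    operadicIdeal (commutatorIdentities k n) m = patternIdeal k n m :=
  le_antisymm (operadicIdeal_le_patternIdeal m) (patternIdeal_le_operadicIdeal n m)

end

/-! ### A basis of the multilinear elements adapted to the ideal -/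

section

variable {X : Type*}

open scoped Classical in
/-- The color of a node with children `s` and `t`: exchanging two different children changes the
color. -/
def color (s t : FreeMagma X) : Bool := decide (WellOrderingRel s t)

theorem color_swap {s t : FreeMagma X} (h : s ≠ t) : color t s = !color s t := by
  unfold color
  rcases trichotomous_of WellOrderingRel s t with h' | h' | h'
  · simp [h', asymm_of WellOrderingRel h']
  · exact absurd h' h
  · simp [h', asymm_of WellOrderingRel h']

/-- A monomial viewed as a colored tree. -/
def toColored : FreeMagma X → ColoredTree X
  | FreeMagma.of x => .leaf x
  | FreeMagma.mul s t => .node (color s t) (toColored s) (toColored t)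

theorem leaves_mul (s t : FreeMagma X) : leaves (s * t) = leaves s + leaves t := rfl

theorem toColored_mul (s t : FreeMagma X) :
    toColored (s * t) = .node (color s t) (toColored s) (toColored t) := rfl

theorem leaves_ne_zero (t : FreeMagma X) : leaves t ≠ 0 := by
  induction t with
  | ih1 x => simp [leaves]
  | ih2 s t hs ht => simp [leaves_mul, hs]

theorem leaves_toColored (t : FreeMagma X) : (toColored t).leaves = leaves t := by
  induction t with
  | ih1 x => rfl
  | ih2 s t hs ht => rw [toColored_mul, ColoredTree.leaves, hs, ht, leaves_mul]

/-- Exchanging children costs at most a sign and does not affect the state, so each node can be put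
in the order that encodes its color. Distinct leaf labels ensure distinct children, without which
only one color would be available. -/
theorem exists_toColored (k : Type*) [Field k] (n : ℕ) {T : ColoredTree X}
    (hT : T.leaves.Nodup) :
    ∃ t : FreeMagma X, leaves t = T.leaves ∧
      (toColored t).state (⊥ : X → PatternState n) = T.state ⊥ ∧
      ∃ a : k, T.eval k = a • (toColored t).eval k := by
  induction T with
  | leaf x => exact ⟨FreeMagma.of x, rfl, rfl, 1, (one_smul _ _).symm⟩
  | node c l r hl hr =>
    rw [ColoredTree.leaves, Multiset.nodup_add] at hT
    obtain ⟨s, hs, hs', a, ha⟩ := hl hT.1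
    obtain ⟨t, ht, ht', b, hb⟩ := hr hT.2.1
    have hst : s ≠ t := by
      rintro rfl
      have h := hT.2.2
      rw [← hs, ← ht, disjoint_self] at h
      exact leaves_ne_zero s h
    by_cases hc : color s t = c
    · refine ⟨s * t, by rw [leaves_mul, hs, ht, ColoredTree.leaves], ?_, a * b, ?_⟩
      · rw [toColored_mul, ColoredTree.state, ColoredTree.state, hs', ht', hc]
      · rw [toColored_mul, ColoredTree.eval, ColoredTree.eval, ha, hb, hc, bracket_smul_left,
          bracket_smul_right, smul_smul]
    · have hc' : color t s = c := by
        rw [color_swap hst]; revert hc; cases color s t <;> cases c <;> simp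
      refine ⟨t * s, by rw [leaves_mul, hs, ht, ColoredTree.leaves, add_comm], ?_,
        a * b * (if c then -1 else 1), ?_⟩
      · rw [toColored_mul, ColoredTree.state, ColoredTree.state, hs', ht', hc',
          PatternState.step_comm]
      · rw [toColored_mul, ColoredTree.eval, ColoredTree.eval, ha, hb, hc', bracket_smul_left,
          bracket_smul_right, bracket_swap, smul_smul, smul_smul]

variable {k : Type*} [Field k]

theorem stateSpan_eq_span {n : ℕ} {S : Multiset X} (hS : S.Nodup) (s : PatternState n) :
    stateSpan k S s = Submodule.span k ((fun t => (toColored t).eval k) ''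
      {t | leaves t = S ∧ s ≤ (toColored t).state ⊥}) := by
  refine le_antisymm (Submodule.span_le.2 ?_) (Submodule.span_mono ?_)
  · rintro _ ⟨T, ⟨rfl, hT⟩, rfl⟩
    obtain ⟨t, ht, ht', a, ha⟩ := exists_toColored k n hS
    rw [SetLike.mem_coe, ha]
    exact Submodule.smul_mem _ _ (Submodule.subset_span ⟨t, ⟨ht, ht' ▸ hT⟩, rfl⟩)
  · rintro _ ⟨t, ⟨rfl, ht⟩, rfl⟩
    exact ⟨toColored t, ⟨leaves_toColored t, ht⟩, rfl⟩

theorem linearIndependent_ofMagma :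
    LinearIndependent k (MonoidAlgebra.ofMagma k (FreeMagma X)) := by
  refine LinearIndependent.of_comp (MonoidAlgebra.coeffLinearEquiv k).toLinearMap ?_
  convert (Finsupp.basisSingleOne (R := k) (ι := FreeMagma X)).linearIndependent using 1
  ext1 t
  simp [MonoidAlgebra.ofMagma]

theorem finrank_homogeneous (S : Multiset X) :
    Module.finrank k (homogeneous k S) = {t : FreeMagma X | leaves t = S}.ncard := by
  have := (finite_leaves_eq S).fintype
  rw [homogeneous, Set.image_eq_range, finrank_span_eq_card, ← Nat.card_eq_fintype_card,
    Nat.card_coe_set_eq]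
  exact linearIndependent_ofMagma.comp _ Subtype.val_injective

/-- The family spans the homogeneous component and has as many members as the monomial basis. -/
theorem linearIndepOn_eval [CharZero k] {S : Multiset X} (hS : S.Nodup) :
    LinearIndepOn k (fun t => (toColored t).eval k) {t : FreeMagma X | leaves t = S} := by
  have := (finite_leaves_eq S).fintype
  refine linearIndependent_iff_card_eq_finrank_span.2 ?_
  rw [Set.finrank, ← Set.image_eq_range (fun t => (toColored t).eval k)]
  -- The least state imposes no condition, so the parameter 0 is an arbitrary choice.
  have h := stateSpan_eq_span (k := k) hS (⊥ : PatternState 0)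
  simp only [bot_le, and_true] at h
  rw [← h, stateSpan_bot, finrank_homogeneous, ← Nat.card_eq_fintype_card, Nat.card_coe_set_eq]

theorem finrank_stateSpan [CharZero k] {n : ℕ} {S : Multiset X} (hS : S.Nodup)
    (s : PatternState n) : Module.finrank k (stateSpan k S s) =
      {t : FreeMagma X | leaves t = S ∧ s ≤ (toColored t).state ⊥}.ncard := by
  have hsub : {t : FreeMagma X | leaves t = S ∧ s ≤ (toColored t).state ⊥} ⊆
    {t | leaves t = S} := fun t ht => ht.1
  have := ((finite_leaves_eq S).subset hsub).fintype
  rw [stateSpan_eq_span hS, Set.image_eq_range, finrank_span_eq_card, ← Nat.card_eq_fintype_card,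
    Nat.card_coe_set_eq]
  exact (linearIndepOn_eval hS).mono hsub

end

/-- The dimension of `NU_n(m)` is the number of the monomials without forbidden patterns. -/
theorem finrank_NU (k : Type*) [Field k] [CharZero k] (n m : ℕ) :
    Module.finrank k (NU k n m) = {t : FreeMagma (Fin m) |
      leaves t = (Finset.univ : Finset (Fin m)).val ∧
        ¬ ((toColored t).state (⊥ : Fin m → PatternState n)).2}.ncard := by
  have h1 := Submodule.finrank_quotient_add_finrank (operadicIdeal (commutatorIdentities k n) m)
  have h2 : Module.finrank k (operadicIdeal (commutatorIdentities k n) m) =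
      {t : FreeMagma (Fin m) | leaves t = (Finset.univ : Finset (Fin m)).val ∧
        ((toColored t).state (⊥ : Fin m → PatternState n)).2}.ncard := by
    rw [operadicIdeal_eq_patternIdeal, patternIdeal,
      (Submodule.comapSubtypeEquivOfLe (q := Mag k m) (stateSpan_le_homogeneous _ _)).finrank_eq,
      finrank_stateSpan Finset.univ.nodup]
    simp only [le_state_iff]
  rw [h2, show Module.finrank k (Mag k m) = _ from finrank_homogeneous _] at h1
  have h3 := Set.ncard_inter_add_ncard_sdiff_eq_ncard
    {t : FreeMagma (Fin m) | leaves t = (Finset.univ : Finset (Fin m)).val}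
    {t | ((toColored t).state (⊥ : Fin m → PatternState n)).2} (finite_leaves_eq _)
  rw [← h1, add_comm] at h3
  exact (Nat.add_right_cancel h3).symm

end MagmaticOperad

/-! ### Algebraicity of the solutions of quadratic systems -/

/-- Elements `y` of an extension `E` of a field `K` of characteristic zero with
`y q = b q + ∑ c q p r * y p * y r` are algebraic over `K` if the Jacobian of this system
does not vanish. -/
theorem isAlgebraic_of_quadratic_system {K E Q : Type*} [Field K] [CharZero K] [Field E]
    [Algebra K E] [Fintype Q] [DecidableEq Q] (y : Q → E) (b : Q → K) (c : Q → Q → Q → K)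
    (hy : ∀ q, y q = algebraMap K E (b q) + ∑ p, ∑ r, algebraMap K E (c q p r) * (y p * y r))
    (hdet : (1 - Matrix.of fun q s =>
      ∑ p, (algebraMap K E (c q p s) * y p + algebraMap K E (c q s p) * y p)).det ≠ 0)
    (q : Q) : IsAlgebraic K (y q) := by
  let L := IntermediateField.adjoin K (Set.range y)
  let z : Q → L := fun q => ⟨y q, IntermediateField.subset_adjoin K _ ⟨q, rfl⟩⟩
  have hz : ∀ q, z q = algebraMap K L (b q) + ∑ p, ∑ r, algebraMap K L (c q p r) * (z p * z r) := by
    intro q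
    apply Subtype.ext
    have := hy q
    simpa [z] using this
  have hfg : L.FG := ⟨(Set.finite_range y).toFinset, by simp [L]⟩
  have : Algebra.EssFiniteType K L := IntermediateField.essFiniteType_iff.2 hfg
  let M : Matrix Q Q L := Matrix.of fun q s =>
    ∑ p, (algebraMap K L (c q p s) * z p + algebraMap K L (c q s p) * z p)
  have hM : (1 - M).det ≠ 0 := by
    intro h
    apply hdet
    have h2 := congrArg (algebraMap L E) h
    rw [RingHom.map_det, map_zero] at h2
    rw [← h2]
    congr 1
    rw [map_sub, map_one]
    congr 1
    ext i j
    simp [M, z]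
  -- Applying `D` to the system gives a homogeneous linear system for the `D (z q)` with the
  -- invertible matrix `1 - M`.
  have hder : ∀ D : Derivation K L L, ∀ q, D (z q) = 0 := by
    intro D
    have h : (1 - M).mulVec (fun q => D (z q)) = 0 := by
      ext1 q
      rw [Matrix.sub_mulVec, Matrix.one_mulVec, Pi.sub_apply, Pi.zero_apply, sub_eq_zero]
      conv_lhs => rw [hz q]
      simp only [map_add, map_sum, Derivation.map_algebraMap, zero_add, Derivation.leibniz,
        mul_zero, add_zero, smul_eq_mul, Matrix.mulVec, dotProduct, M, Matrix.of_apply,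
        Finset.sum_add_distrib, mul_add, add_mul, Finset.sum_mul]
      congr 1
      · rw [Finset.sum_comm]
        refine Finset.sum_congr rfl fun _ _ => Finset.sum_congr rfl fun _ _ => by ring
      · refine Finset.sum_congr rfl fun _ _ => Finset.sum_congr rfl fun _ _ => by ring
    exact fun q => congrFun (Matrix.eq_zero_of_mulVec_eq_zero hM h) q
  have hder' : ∀ D : Derivation K L L, ∀ x, D x = 0 := by
    rintro D ⟨x, hx⟩
    induction hx using IntermediateField.adjoin_induction with
    | mem x hx => obtain ⟨q, rfl⟩ := hx; exact hder D q
    | algebraMap x => exact D.map_algebraMap x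
    | add x y hx hy h1 h2 =>
      have := D.map_add ⟨x, hx⟩ ⟨y, hy⟩
      rw [h1, h2, add_zero] at this
      exact this
    | inv x hx h =>
      have := D.leibniz_inv ⟨x, hx⟩
      rw [h, smul_zero] at this
      exact this
    | mul x y hx hy h1 h2 =>
      have := D.leibniz ⟨x, hx⟩ ⟨y, hy⟩
      rw [h1, h2, smul_zero, smul_zero, add_zero] at this
      exact this
  have hD : ∀ x : L, KaehlerDifferential.D K L x = 0 := by
    intro x
    -- Linear forms separate the points of the module of differentials, and each one composed with
    -- the universal derivation is a derivation of `L` into itself.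
    rw [← Module.forall_dual_apply_eq_zero_iff L]
    intro φ
    exact hder' (φ.compDer (KaehlerDifferential.D K L)) x
  have hsub : Subsingleton (Ω[L⁄K]) := by
    rw [← Submodule.subsingleton_iff L, ← subsingleton_iff_bot_eq_top,
      ← KaehlerDifferential.span_range_derivation]
    symm
    rw [Submodule.span_eq_bot]
    rintro _ ⟨x, rfl⟩
    exact hD x
  have : Algebra.FormallyUnramified K L := ⟨hsub⟩
  -- A finitely generated field extension without differentials is separable algebraic.
  have := Algebra.FormallyUnramified.isSeparable K L
  have h := Algebra.IsSeparable.isIntegral K (z q)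
  exact (isAlgebraic_algebraMap_iff (algebraMap L E).injective).2 h.isAlgebraic

/-- The solutions without constant term of a quadratic system over `ℚ[X]` are algebraic. -/
theorem PowerSeries.isAlgebraic_of_quadratic_system {Q : Type*} [Fintype Q] (y : Q → ℚ⟦X⟧)
    (b : Q → ℚ[X]) (c : Q → Q → Q → ℚ) (h0 : ∀ q, constantCoeff (y q) = 0)
    (hy : ∀ q, y q = b q + ∑ p, ∑ r, PowerSeries.C (c q p r) * (y p * y r)) (q : Q) :
    IsAlgebraic ℚ[X] (y q) := by
  classical
  let E := FractionRing ℚ⟦X⟧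
  let K := FractionRing ℚ[X]
  have hinj : Function.Injective (algebraMap ℚ[X] ℚ⟦X⟧) := Polynomial.coe_injective ℚ
  have : FaithfulSMul ℚ[X] ℚ⟦X⟧ := (faithfulSMul_iff_algebraMap_injective _ _).2 hinj
  have : FaithfulSMul ℚ[X] E := FaithfulSMul.trans ℚ[X] ℚ⟦X⟧ E
  let _ : Algebra K E := FractionRing.liftAlgebra ℚ[X] E
  have hst : IsScalarTower ℚ[X] K E := inferInstance
  have hinj' := IsFractionRing.injective ℚ⟦X⟧ E
  have hC : ∀ a : ℚ, algebraMap K E (algebraMap ℚ[X] K (Polynomial.C a)) =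
      algebraMap ℚ⟦X⟧ E (PowerSeries.C a) := by
    intro a
    rw [← IsScalarTower.algebraMap_apply, IsScalarTower.algebraMap_apply ℚ[X] ℚ⟦X⟧ E]
    congr 1
    exact Polynomial.coe_C a
  have hb : ∀ a : ℚ[X], algebraMap K E (algebraMap ℚ[X] K a) =
      algebraMap ℚ⟦X⟧ E (a : ℚ⟦X⟧) := by
    intro a
    rw [← IsScalarTower.algebraMap_apply, IsScalarTower.algebraMap_apply ℚ[X] ℚ⟦X⟧ E]
    rfl
  rw [← isAlgebraic_algebraMap_iff hinj', IsFractionRing.isAlgebraic_iff ℚ[X] K E]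
  refine _root_.isAlgebraic_of_quadratic_system (fun q => algebraMap ℚ⟦X⟧ E (y q))
    (fun q => algebraMap ℚ[X] K (b q))
    (fun q p r => algebraMap ℚ[X] K (Polynomial.C (c q p r))) ?_ ?_ q
  · intro q
    conv_lhs => rw [hy q]
    simp only [map_add, map_sum, map_mul, hC, hb]
  · let M : Matrix Q Q ℚ⟦X⟧ := Matrix.of fun q s =>
      ∑ p, (PowerSeries.C (c q p s) * y p + PowerSeries.C (c q s p) * y p)
    -- The entries of `M` are linear in the `y p`, so `M` vanishes at zero.
    have h1 : PowerSeries.constantCoeff (1 - M).det = 1 := by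
      rw [RingHom.map_det, map_sub, map_one]
      have : (PowerSeries.constantCoeff (R := ℚ)).mapMatrix M = 0 := by
        ext i j
        simp [M, h0]
      rw [this, sub_zero, Matrix.det_one]
    have h2 : (1 - M).det ≠ 0 := by
      intro h
      rw [h, map_zero] at h1
      exact zero_ne_one h1
    have h3 : algebraMap ℚ⟦X⟧ E (1 - M).det ≠ 0 := by
      rwa [Ne, map_eq_zero_iff _ hinj']
    convert h3 using 1
    rw [RingHom.map_det, map_sub, map_one]
    congr 2
    ext i j
    simp [M, hC]

namespace MagmaticOperad

/-! ### Counting the monomials with a given state -/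

section

variable {X : Type*}

/-- The monomials with the set of leaves `S`, without repetitions. -/
def multilinearMonomials (S : Finset X) : Finset (FreeMagma X) :=
  (finite_leaves_eq S.val).toFinset

theorem mem_multilinearMonomials {S : Finset X} {t : FreeMagma X} :
    t ∈ multilinearMonomials S ↔ leaves t = S.val := by
  simp [multilinearMonomials]

theorem multilinearMonomials_empty : multilinearMonomials (∅ : Finset X) = ∅ := by
  ext t
  simp [mem_multilinearMonomials, leaves_ne_zero]

theorem multilinearMonomials_singleton (x : X) :
    multilinearMonomials {x} = {FreeMagma.of x} := by
  ext t
  rw [mem_multilinearMonomials, Finset.mem_singleton, Finset.singleton_val]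
  constructor
  · intro h
    cases t with
    | of y => rw [leaves, Multiset.singleton_inj] at h; rw [h]
    | mul s t =>
      have h' := congrArg Multiset.card h
      change Multiset.card (leaves s + leaves t) = 1 at h'
      have hs := Multiset.card_pos.2 (leaves_ne_zero s)
      have ht := Multiset.card_pos.2 (leaves_ne_zero t)
      rw [Multiset.card_add] at h'
      omega
  · rintro rfl
    rfl

open scoped Classical in
theorem sum_multilinearMonomials {M : Type*} [AddCommMonoid M] {S : Finset X} (hS : 1 < S.card)
    (f : FreeMagma X → M) : ∑ t ∈ multilinearMonomials S, f t =
      ∑ A ∈ S.powerset, ∑ s ∈ multilinearMonomials A, ∑ t ∈ multilinearMonomials (S \ A),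
        f (s * t) := by
  simp_rw [← Finset.sum_product', Finset.sum_sigma']
  symm
  refine Finset.sum_bij (fun x _ => x.2.1 * x.2.2) ?_ ?_ ?_ (fun _ _ => rfl)
  · rintro ⟨A, s, t⟩ h
    simp only [Finset.mem_sigma, Finset.mem_powerset, Finset.mem_product,
      mem_multilinearMonomials] at h ⊢
    rw [leaves_mul, h.2.1, h.2.2, Finset.sdiff_val,
      add_tsub_cancel_of_le (Finset.val_le_iff.2 h.1)]
  · rintro ⟨A, s, t⟩ h ⟨B, s', t'⟩ h' heq
    simp only [Finset.mem_sigma, Finset.mem_powerset, Finset.mem_product,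
      mem_multilinearMonomials] at h h'
    have heq : FreeMagma.mul s t = FreeMagma.mul s' t' := heq
    obtain ⟨rfl, rfl⟩ : s = s' ∧ t = t' := by injection heq with h1 h2; exact ⟨h1, h2⟩
    obtain rfl : A = B := Finset.val_inj.1 (h.2.1.symm.trans h'.2.1)
    rfl
  · intro u hu
    rw [mem_multilinearMonomials] at hu
    cases u with
    | of x =>
      have := congrArg Multiset.card hu
      rw [leaves, Multiset.card_singleton, Finset.card_val] at this
      omega
    | mul s t =>
      have hu : leaves s + leaves t = S.val := hu
      have hnd : (leaves s + leaves t).Nodup := hu ▸ S.nodup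
      rw [Multiset.nodup_add] at hnd
      refine ⟨⟨⟨leaves s, hnd.1⟩, s, t⟩, ?_, rfl⟩
      simp only [Finset.mem_sigma, Finset.mem_powerset, Finset.mem_product,
        mem_multilinearMonomials, Finset.sdiff_val]
      exact ⟨Finset.val_le_iff.1 (hu ▸ Multiset.le_add_right _ _), trivial,
        by rw [← hu, add_tsub_cancel_left]⟩

open scoped Classical in
-- Replacing A by its complement exchanges the two factors at the root. Counting both orders
-- together prepares for summing over colors instead.
theorem two_nsmul_sum_multilinearMonomials {M : Type*} [AddCommMonoid M] {S : Finset X}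
    (hS : 1 < S.card) (f : FreeMagma X → M) : 2 • ∑ t ∈ multilinearMonomials S, f t =
      ∑ A ∈ S.powerset, ∑ s ∈ multilinearMonomials A, ∑ t ∈ multilinearMonomials (S \ A),
        (f (s * t) + f (t * s)) := by
  have h : ∑ t ∈ multilinearMonomials S, f t =
      ∑ A ∈ S.powerset, ∑ s ∈ multilinearMonomials A, ∑ t ∈ multilinearMonomials (S \ A),
        f (t * s) := by
    rw [sum_multilinearMonomials hS]
    refine Finset.sum_nbij' (S \ ·) (S \ ·) ?_ ?_ ?_ ?_ ?_
    · simp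
    · simp
    · exact fun A hA => Finset.sdiff_sdiff_eq_self (Finset.mem_powerset.1 hA)
    · exact fun A hA => Finset.sdiff_sdiff_eq_self (Finset.mem_powerset.1 hA)
    · intro A hA
      rw [Finset.sdiff_sdiff_eq_self (Finset.mem_powerset.1 hA), Finset.sum_comm]
  rw [two_nsmul]
  nth_rw 1 [sum_multilinearMonomials hS]
  rw [h]
  simp only [Finset.sum_add_distrib]

open scoped Classical in
/-- The number of the monomials with the set of leaves `S` and the state `q`. -/
def stateCount {n : ℕ} (S : Finset X) (q : PatternState n) : ℕ :=
  {t ∈ multilinearMonomials S | (toColored t).state ⊥ = q}.card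

open scoped Classical in
/-- The number of the colors of a node that lead from the states `p` and `r` to `q`. -/
def colorCount {n : ℕ} (q p r : PatternState n) : ℕ :=
  ∑ c : Bool, if PatternState.step c p r = q then 1 else 0

theorem stateCount_empty {n : ℕ} (q : PatternState n) : stateCount (∅ : Finset X) q = 0 := by
  simp [stateCount, multilinearMonomials_empty]

open scoped Classical in
theorem stateCount_singleton {n : ℕ} (x : X) (q : PatternState n) :
    stateCount {x} q = if q = ⊥ then 1 else 0 := by
  have h : (toColored (FreeMagma.of x)).state (⊥ : X → PatternState n) = ⊥ := rfl
  rw [stateCount, multilinearMonomials_singleton, Finset.filter_singleton, h]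
  by_cases hq : q = ⊥
  · simp [hq]
  · simp [hq, Ne.symm hq]

open scoped Classical in
-- For distinct s and t, the products st and ts carry opposite colors at the root, and
-- `PatternState.step` ignores the order. Their joint contribution is `colorCount`, which no longer
-- refers to the chosen well-ordering.
theorem two_mul_stateCount {n : ℕ} {S : Finset X} (hS : 1 < S.card) (q : PatternState n) :
    2 * stateCount S q = ∑ A ∈ S.powerset, ∑ p : PatternState n, ∑ r : PatternState n,
      colorCount q p r * (stateCount A p * stateCount (S \ A) r) := by
  rw [stateCount, Finset.card_filter, ← smul_eq_mul, two_nsmul_sum_multilinearMonomials hS]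
  refine Finset.sum_congr rfl fun A hA => ?_
  have h : ∀ s ∈ multilinearMonomials A, ∀ t ∈ multilinearMonomials (S \ A),
      ((if (toColored (s * t)).state ⊥ = q then 1 else 0) +
        (if (toColored (t * s)).state ⊥ = q then 1 else 0)) =
      colorCount q ((toColored s).state ⊥) ((toColored t).state ⊥) := by
    intro s hs t ht
    rw [mem_multilinearMonomials] at hs ht
    have hst : s ≠ t := by
      rintro rfl
      have hA' : A = S \ A := Finset.val_inj.1 (hs.symm.trans ht)
      have hd : Disjoint A (S \ A) := Finset.disjoint_sdiff
      rw [← hA', disjoint_self] at hd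
      rw [hd] at hs
      exact leaves_ne_zero s hs
    rw [toColored_mul, toColored_mul, ColoredTree.state, ColoredTree.state, color_swap hst,
      PatternState.step_comm (!color s t), colorCount, Fintype.sum_bool]
    cases color s t
    · exact add_comm _ _
    · rfl
  rw [Finset.sum_congr rfl fun s hs => Finset.sum_congr rfl fun t ht => h s hs t ht]
  rw [← Finset.sum_fiberwise (multilinearMonomials A) (fun s => (toColored s).state ⊥)]
  refine Finset.sum_congr rfl fun p _ => ?_
  have h' : ∀ s ∈ {s ∈ multilinearMonomials A | (toColored s).state ⊥ = p},
      ∑ t ∈ multilinearMonomials (S \ A),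
        colorCount q ((toColored s).state ⊥) ((toColored t).state ⊥) =
      ∑ r : PatternState n, colorCount q p r * stateCount (S \ A) r := by
    intro s hs
    rw [(Finset.mem_filter.1 hs).2,
      ← Finset.sum_fiberwise (multilinearMonomials (S \ A)) (fun t => (toColored t).state ⊥)]
    refine Finset.sum_congr rfl fun r _ => ?_
    rw [Finset.sum_congr rfl fun t ht => by rw [(Finset.mem_filter.1 ht).2],
      Finset.sum_const, smul_eq_mul, mul_comm, stateCount]
  rw [Finset.sum_congr rfl h', Finset.sum_const, smul_eq_mul, Finset.mul_sum]
  refine Finset.sum_congr rfl fun r _ => ?_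
  exact mul_left_comm _ _ _

/-- The number of the monomials in `m` given variables with the state `q`. -/
def stateNumber {n : ℕ} (m : ℕ) (q : PatternState n) : ℕ := stateCount (Finset.range m) q

open scoped Classical in
theorem two_mul_stateCount_of_forall {n : ℕ} {S : Finset X} (hS : 1 < S.card)
    (h : ∀ A : Finset X, A.card < S.card → ∀ q : PatternState n,
      stateCount A q = stateNumber A.card q) (q : PatternState n) :
    2 * stateCount S q = ∑ i ∈ Finset.range (S.card + 1), S.card.choose i *
      ∑ p : PatternState n, ∑ r : PatternState n,
        colorCount q p r * (stateNumber i p * stateNumber (S.card - i) r) := by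
  have h0 : ∀ q : PatternState n, stateNumber 0 q = 0 := fun q => stateCount_empty q
  have hsum := Finset.sum_powerset_apply_card (x := S) (fun i =>
    ∑ p : PatternState n, ∑ r : PatternState n,
        colorCount q p r * (stateNumber i p * stateNumber (S.card - i) r))
  simp only [smul_eq_mul] at hsum
  rw [two_mul_stateCount hS, ← hsum]
  refine Finset.sum_congr rfl fun A hA => Finset.sum_congr rfl fun p _ =>
    Finset.sum_congr rfl fun r _ => ?_
  rw [Finset.mem_powerset] at hA
  have hc := Finset.card_sdiff_of_subset hA
  have hle := Finset.card_le_card hA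
  congr 1
  -- If A or its complement is empty, the other part is all of S and escapes the hypothesis on
  -- smaller sets, but the term vanishes.
  rcases Finset.eq_empty_or_nonempty A with rfl | h1
  · rw [stateCount_empty, Finset.card_empty, h0, zero_mul, zero_mul]
  rcases Finset.eq_empty_or_nonempty (S \ A) with h2 | h2
  · rw [h2, Finset.card_empty] at hc
    rw [h2, stateCount_empty, ← hc, h0, mul_zero, mul_zero]
  have := Finset.card_pos.2 h1
  have := Finset.card_pos.2 h2
  rw [h A (by omega), h (S \ A) (by omega), hc]

/-- Renaming variables need not respect the well-ordering behind `color`, so bijections of the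
variables are of no direct use. Independence of S follows from the recursion, which sees only
cardinalities. -/
theorem stateCount_eq {X : Type} {n : ℕ} (S : Finset X) (q : PatternState n) :
    stateCount S q = stateNumber S.card q := by
  classical
  induction hm : S.card using Nat.strong_induction_on generalizing X q with
  | _ m ih =>
    subst hm
    rcases lt_trichotomy S.card 1 with h | h | h
    · obtain rfl : S = ∅ := Finset.card_eq_zero.1 (by omega)
      exact (stateCount_empty q).trans (stateCount_empty q).symm
    · obtain ⟨x, rfl⟩ := Finset.card_eq_one.1 h
      exact (stateCount_singleton x q).trans (stateCount_singleton 0 q).symm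
    · have hc := Finset.card_range S.card
      have h1 := two_mul_stateCount_of_forall h (fun A hA q => ih _ hA A q rfl) q
      have h2 := two_mul_stateCount_of_forall (S := Finset.range S.card) (by rwa [hc])
        (fun A hA q => ih _ (by rwa [hc] at hA) A q rfl) q
      rw [hc] at h2
      exact Nat.eq_of_mul_eq_mul_left two_pos (h1.trans h2.symm)

open scoped Classical in
theorem two_mul_stateNumber {n m : ℕ} (hm : 1 < m) (q : PatternState n) :
    2 * stateNumber m q = ∑ i ∈ Finset.range (m + 1), m.choose i *
      ∑ p : PatternState n, ∑ r : PatternState n,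
        colorCount q p r * (stateNumber i p * stateNumber (m - i) r) := by
  have h := two_mul_stateCount_of_forall (S := Finset.range m) (by rwa [Finset.card_range])
    (fun A _ q => stateCount_eq A q) q
  rwa [Finset.card_range] at h

end

/-! ### Generating series of the states and their quadratic system -/

/-- The exponential generating series of the numbers of the monomials with the state `q`. -/
def stateSeries {n : ℕ} (q : PatternState n) : ℚ⟦X⟧ :=
  PowerSeries.mk fun m => (stateNumber m q : ℚ) / m.factorial

open scoped Classical in
-- The binomial recursion for the counts is a product of exponential series; the factor 1/2 undoes
-- the double count of the splittings at the root, and a single leaf gives the term z in the state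
-- ⊥.
theorem stateSeries_eq {n : ℕ} (q : PatternState n) :
    stateSeries q = ((if q = ⊥ then Polynomial.X else 0 : ℚ[X]) : ℚ⟦X⟧) +
      ∑ p : PatternState n, ∑ r : PatternState n,
        PowerSeries.C ((colorCount q p r : ℚ) / 2) * (stateSeries p * stateSeries r) := by
  have h0 : ∀ q : PatternState n, stateNumber 0 q = 0 := fun q => stateCount_empty q
  ext m
  simp only [map_add, map_sum, PowerSeries.coeff_C_mul, Polynomial.coeff_coe]
  simp only [PowerSeries.coeff_mul, stateSeries, PowerSeries.coeff_mk]
  rcases lt_trichotomy m 1 with h | rfl | h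
  · obtain rfl : m = 0 := by omega
    split_ifs <;> simp [h0]
  · have h1 : stateNumber 1 q = if q = ⊥ then 1 else 0 := stateCount_singleton 0 q
    rw [h1, show Finset.HasAntidiagonal.antidiagonal 1 = {(0, 1), (1, 0)} from rfl]
    split_ifs <;> simp [h0]
  · have h1 : (if q = ⊥ then Polynomial.X else 0 : ℚ[X]).coeff m = 0 := by
      split_ifs
      · exact Polynomial.coeff_X_of_ne_one (by omega)
      · simp
    have h2 := congrArg (Nat.cast (R := ℚ)) (two_mul_stateNumber h q)
    push_cast at h2
    have hf : ∀ i : ℕ, (i.factorial : ℚ) ≠ 0 := fun i => by exact_mod_cast i.factorial_ne_zero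
    rw [h1, zero_add, div_eq_iff (hf m), ← mul_right_inj' (two_ne_zero (α := ℚ)), h2]
    simp only [Finset.Nat.sum_antidiagonal_eq_sum_range_succ_mk, Finset.mul_sum, Finset.sum_mul]
    rw [Finset.sum_comm]
    refine Finset.sum_congr rfl fun p _ => ?_
    rw [Finset.sum_comm]
    refine Finset.sum_congr rfl fun r _ => Finset.sum_congr rfl fun i hi => ?_
    rw [Nat.cast_choose ℚ (Nat.lt_succ_iff.1 (Finset.mem_range.1 hi))]
    field_simp [hf]

theorem isAlgebraic_stateSeries {n : ℕ} (q : PatternState n) :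
    IsAlgebraic ℚ[X] (stateSeries q) := by
  classical
  refine PowerSeries.isAlgebraic_of_quadratic_system stateSeries _ _ (fun q => ?_)
    stateSeries_eq q
  have h0 : stateNumber 0 q = 0 := stateCount_empty q
  simp [stateSeries, ← PowerSeries.coeff_zero_eq_constantCoeff_apply, h0]

open scoped Classical in
theorem finrank_NU_eq_sum (k : Type*) [Field k] [CharZero k] (n m : ℕ) :
    Module.finrank k (NU k n m) = ∑ q : PatternState n with ¬ q.2, stateNumber m q := by
  have h : {t : FreeMagma (Fin m) | leaves t = (Finset.univ : Finset (Fin m)).val ∧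
        ¬ ((toColored t).state (⊥ : Fin m → PatternState n)).2} =
      ({t ∈ multilinearMonomials (Finset.univ : Finset (Fin m)) |
        ¬ ((toColored t).state (⊥ : Fin m → PatternState n)).2} : Finset _) := by
    ext t
    simp [mem_multilinearMonomials]
  rw [finrank_NU, h, Set.ncard_coe_finset,
    Finset.card_eq_sum_card_fiberwise (f := fun t => (toColored t).state ⊥)
      (t := {q : PatternState n | ¬ q.2})]
  · refine Finset.sum_congr rfl fun q hq => ?_
    have := stateCount_eq (Finset.univ : Finset (Fin m)) q
    rw [Finset.card_univ, Fintype.card_fin] at this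
    rw [← this, stateCount, Finset.filter_filter]
    congr 1
    refine Finset.filter_congr fun t _ => and_iff_right_of_imp ?_
    rintro rfl
    exact (Finset.mem_filter.1 hq).2
  · intro t ht
    simpa using (Finset.mem_filter.1 ht).2

open scoped Classical in
theorem expGenSeries_NU (k : Type*) [Field k] [CharZero k] (n : ℕ) :
    expGenSeries k (fun m => NU k n m) = ∑ q : PatternState n with ¬ q.2, stateSeries q := by
  ext m
  simp only [expGenSeries, stateSeries, PowerSeries.coeff_mk, map_sum, finrank_NU_eq_sum,
    Nat.cast_sum, Finset.sum_div]
  split_ifs with h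
  · subst h
    have h0 : ∀ q : PatternState n, stateNumber 0 q = 0 := fun q => stateCount_empty q
    simp [h0]
  · rfl

end MagmaticOperad

end

theorem mainTheorem8 (k : Type*) [Field k] [CharZero k] (n : ℕ) (hn : 2 ≤ n) :
    IsAlgebraic ℚ[X] (expGenSeries k (fun m => MagmaticOperad.NU k n m)) := by
  classical
  rw [MagmaticOperad.expGenSeries_NU]
  -- There are finitely many states, and algebraic elements are closed under addition.
  exact Subalgebra.sum_mem (Subalgebra.algebraicClosure ℚ[X] ℚ⟦X⟧)
    fun q _ => MagmaticOperad.isAlgebraic_stateSeries q
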